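/- Let $S$ be a closed connected orientable surface of genus $g$ with a finite set $P$ of $n$ marked points (punctures), and assume that its Euler characteristic $2-2g-n$ is negative. An arc is the image of a continuous map $\alpha:[0,1]\to S$ that is injective on $(0,1)$, with $\alpha(0),\alpha(1)\in P$ and $\alpha((0,1))\cap P=\emptyset$; it is essential if it does not bound a disk without marked points in its interior. Let $\Gamma$ be a finite simplicial graph whose vertices are placed injectively at marked points of $S$, and let $\Gamma_0$ be the graph obtained from $\Gamma$ by deleting all isolated vertices. An isotopy class (relative to endpoints) of essential arcs is compatible with $\Gamma$ if some edge of $\Gamma$ has the same endpoints. The matching arc complex $\mathcal{MA}(S,\Gamma)$ is the simplicial complex whose $k$-simplices are the sets of $k+1$ compatible isotopy classes of arcs that are pairwise completely disjoint, i.e. any two have geometric intersection number $0$ (endpoints not counted) and no common endpoint. Suppose that $|\Gamma_0|\le 3$, and that we are not in the case where $S$ is the sphere with exactly three marked points and $\Gamma$ has exactly one edge. Then $\mathcal{MA}(S,\Gamma)$ is not connected. (The empty complex counts as not connected.) -/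

import Mathlib

open scoped unitInterval

namespace MatchingArc

section Surface

variable (S : Type*) [TopologicalSpace S]

/-- A surface is orientable if it contains no embedded (closed) Möbius band. Such a band is given
by a continuous map from the rectangle `[0,1] × [0,1]` that makes no identifications besides
gluing `(0, t)` to `(1, 1 - t)`. -/
def IsOrientableSurface : Prop :=
  ¬ ∃ φ : C(I × I, S), ∀ a b : I × I, φ a = φ b ↔
    (a = b ∨ (a.1 = 0 ∧ b.1 = 1 ∧ b.2 = σ a.2) ∨ (a.1 = 1 ∧ b.1 = 0 ∧ b.2 = σ a.2))

/-- A closed connected orientable surface `S` has genus `g` if its first integral homology group,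
that is, the abelianization of its fundamental group, has rank `2 * g`. -/
def HasGenus (g : ℕ) : Prop :=
  ∀ x : S, Module.finrank ℤ (Additive (Abelianization (FundamentalGroup S x))) = 2 * g

end Surface

/-- The Euler characteristic of the orientable surface of genus `g` with `n` punctures. -/
def eulerChar (g n : ℕ) : ℤ := 2 - 2 * (g : ℤ) - (n : ℤ)

section Arcs

variable {S : Type*} [TopologicalSpace S]

/-- A parametrized arc on `S` with set of marked points `P`: a map `[0,1] → S` which is injective
on `(0,1)`, has its endpoints in `P`, and maps `(0,1)` to the complement of `P`. -/
structure IsArcMap (P : Set S) (α : I → S) : Prop where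
  continuous : Continuous α
  injOn : Set.InjOn α (Set.Ioo 0 1)
  zero_mem : α 0 ∈ P
  one_mem : α 1 ∈ P
  notMem : ∀ t ∈ Set.Ioo (0 : I) 1, α t ∉ P

/-- An arc is the image of a parametrized arc. -/
def IsArc (P A : Set S) : Prop :=
  ∃ α : I → S, IsArcMap P α ∧ Set.range α = A

/-- `A` bounds a disk on `(S, P)`: there is an embedded closed disk with boundary `A` and with no
marked point (puncture) in its interior. -/
def BoundsDisk (P A : Set S) : Prop :=
  ∃ D : EuclideanSpace ℝ (Fin 2) → S,
    ContinuousOn D (Metric.closedBall 0 1) ∧ Set.InjOn D (Metric.closedBall 0 1) ∧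
    D '' Metric.sphere 0 1 = A ∧ ∀ x ∈ Metric.ball (0 : EuclideanSpace ℝ (Fin 2)) 1, D x ∉ P

/-- Essential arcs on `(S, P)`, as subsets of `S`. -/
abbrev EssentialArc (P : Set S) : Type _ :=
  {A : Set S // IsArc P A ∧ ¬ BoundsDisk P A}

/-- Isotopy relative to endpoints: a continuous family of parametrized arcs with fixed endpoints,
starting at a parametrization of `A` and ending at a parametrization of `B`. -/
def Isotopic {P : Set S} (A B : EssentialArc P) : Prop :=
  ∃ H : I → I → S, Continuous (fun p : I × I => H p.1 p.2) ∧
    (∀ s, IsArcMap P (H s)) ∧ (∀ s, H s 0 = H 0 0) ∧ (∀ s, H s 1 = H 0 1) ∧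
    Set.range (H 0) = A.1 ∧ Set.range (H 1) = B.1

/-- Isotopy classes of essential arcs: the quotient by the equivalence relation generated by
isotopy. -/
def ArcClass (P : Set S) : Type _ := Quot (Isotopic (P := P))

/-- The isotopy class of an essential arc. -/
def ArcClass.mk {P : Set S} (A : EssentialArc P) : ArcClass P := Quot.mk _ A

theorem range_inter_marked {P : Set S} {α : I → S} (h : IsArcMap P α) :
    Set.range α ∩ P = {α 0, α 1} := by
  ext x
  constructor
  · rintro ⟨⟨t, rfl⟩, hx⟩
    by_cases h0 : t = 0
    · left; rw [h0]
    by_cases h1 : t = 1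
    · right; rw [h1]; rfl
    exact absurd hx (h.notMem t
      ⟨unitInterval.pos_iff_ne_zero.2 h0, unitInterval.lt_one_iff_ne_one.2 h1⟩)
  · rintro (rfl | rfl)
    · exact ⟨⟨0, rfl⟩, h.zero_mem⟩
    · exact ⟨⟨1, rfl⟩, h.one_mem⟩

/-- The set of endpoints of an isotopy class of arcs: the marked points that lie on a
representative. -/
def ArcClass.endpoints {P : Set S} (c : ArcClass P) : Set S :=
  Quot.lift (fun A : EssentialArc P => A.1 ∩ P) (by
    rintro A B ⟨H, -, hH, h0, h1, hA, hB⟩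
    change A.1 ∩ P = B.1 ∩ P
    rw [← hA, ← hB, range_inter_marked (hH 0), range_inter_marked (hH 1), h0 1, h1 1]) c

/-- The geometric intersection number: the minimal number of intersection points, endpoints
(i.e. marked points) not counted, between representatives. -/
noncomputable def ArcClass.geomInter {P : Set S} (c d : ArcClass P) : ℕ∞ :=
  ⨅ (A : {A : EssentialArc P // ArcClass.mk A = c})
    (B : {B : EssentialArc P // ArcClass.mk B = d}),
    ((A.1.1 ∩ B.1.1) \ P).encard

/-- Two arcs are completely disjoint if their geometric intersection number vanishes and they have
no endpoint in common. -/
def ArcClass.CompletelyDisjoint {P : Set S} (c d : ArcClass P) : Prop :=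
  c.geomInter d = 0 ∧ Disjoint c.endpoints d.endpoints

/-- An arc is compatible with the graph `Γ`, whose vertices are placed at marked points by `ι`, if
some edge of `Γ` has the same endpoints. -/
def ArcClass.Compatible {P : Set S} {V : Type*} (Γ : SimpleGraph V) (ι : V ↪ P)
    (c : ArcClass P) : Prop :=
  ∃ u v : V, Γ.Adj u v ∧ c.endpoints = {(ι u : S), (ι v : S)}

/-- The matching arc complex: its vertices are the arcs compatible with `Γ`, and its simplices are
the finite nonempty sets of pairwise completely disjoint compatible arcs. -/
def matchingArcComplex {P : Set S} {V : Type*} (Γ : SimpleGraph V) (ι : V ↪ P) :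
    AbstractSimplicialComplex {c : ArcClass P // c.Compatible Γ ι} where
  faces := {s | s.Nonempty ∧
    (s : Set {c : ArcClass P // c.Compatible Γ ι}).Pairwise
      (fun c d => ArcClass.CompletelyDisjoint c.1 d.1)}
  isRelLowerSet_faces := fun _ hs =>
    ⟨hs.1, fun _ hts ht => ⟨ht, hs.2.mono (Finset.coe_subset.2 hts)⟩⟩
  singleton_mem := fun v => ⟨Finset.singleton_nonempty v, by simp⟩

end Arcs

/-- The 1-skeleton of an abstract simplicial complex. -/
def oneSkeleton {X : Type*} (K : AbstractSimplicialComplex X) : SimpleGraph X where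
  Adj v w := v ≠ w ∧ ∃ s ∈ K.faces, v ∈ s ∧ w ∈ s
  symm := ⟨fun _ _ h => ⟨h.1.symm, h.2.imp fun _ hs => ⟨hs.1, hs.2.2, hs.2.1⟩⟩⟩
  loopless := ⟨fun _ h => h.1 rfl⟩

/-- A simplicial complex is connected if it is nonempty and any two of its vertices are joined by
an edge path. -/
def IsConnectedComplex {X : Type*} (K : AbstractSimplicialComplex X) : Prop :=
  (oneSkeleton K).Connected

/-- The vertices of the graph `Γ₀` obtained from `Γ` by deleting every isolated vertex. -/
def coreVertices {V : Type*} (Γ : SimpleGraph V) : Set V := {v | ¬ Γ.IsIsolated v}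

end MatchingArc

/-! Two distinct completely disjoint compatible arcs use two edges of `Γ` without a common vertex,
hence four vertices of the core. With at most three core vertices the 1-skeleton therefore has no
edges, and a connected complex would be a single vertex (`subsingleton_of_isConnectedComplex`). So,
as soon as `Γ` has an edge `uv`, it suffices to find two different compatible classes.

A third core vertex yields an edge with another endpoint set, hence another class. If the core is
`{u, v}`, two non-isotopic arcs from `u` to `v` are needed. With at least four marked points, all of
them are placed in one coordinate plane, and two arcs passing on either side of a marked point are
told apart by a winding number: a Möbius map sends two other marked points to `∞` and `0`
(`exists_arcClass_ne_of_four_le_card`). With at most three marked points, the negative Euler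
characteristic and the excluded case force `g ≥ 1`. If all arcs from `u` to `v` were isotopic,
pushing `v` around a loop would change an arc by that loop without changing its homotopy class, so
`S` would be simply connected (`subsingleton_fundamentalGroup`), against the rank `2g` of the first
homology.

Both halves rest on point pushing: every path off a finite set `F` is homotopic to the track of a
push fixing `F` (`isRealizable_of_notMem`). -/

namespace MatchingArc

open Set Topology Filter

/-! ### Extending maps from an open piece -/

section Gluing

variable {X Y Z : Type*} [TopologicalSpace X] [TopologicalSpace Y] [TopologicalSpace Z]

/-- A map defined on an open piece of `Y` that agrees with a globally defined map off a closed
subset of `Y` extends to `Y`, and the extension is continuous wherever the local data are. -/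
theorem continuousAt_extend {ψ : X → Y} (hψ : IsOpenEmbedding ψ) {C : Set X}
    (hC : IsClosed (ψ '' C)) {Φ : X → Z} {b : Y → Z} (hb : Continuous b)
    (hagree : ∀ x ∉ C, Φ x = b (ψ x)) {y : Y}
    (hy : ∀ x, ψ x = y → ContinuousAt Φ x) : ContinuousAt (Function.extend ψ Φ b) y := by
  by_cases h : ∃ x, ψ x = y
  · obtain ⟨x, rfl⟩ := h
    rw [← hψ.continuousAt_iff, Function.extend_comp hψ.injective]
    exact hy x rfl
  · have hyC : y ∈ (ψ '' C)ᶜ := fun ⟨x, _, hx⟩ => h ⟨x, hx⟩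
    refine (hb.continuousAt).congr ?_
    filter_upwards [hC.isOpen_compl.mem_nhds hyC] with z hz
    by_cases hz' : ∃ x, ψ x = z
    · obtain ⟨x, rfl⟩ := hz'
      rw [hψ.injective.extend_apply, hagree x fun hx => hz ⟨x, hx, rfl⟩]
    · rw [Function.extend_apply' _ _ _ hz']

end Gluing

/-! ### Coordinate planes; deleting finitely many points -/

section Charts

variable {S : Type*} [TopologicalSpace S] [ChartedSpace (EuclideanSpace ℝ (Fin 2)) S]

theorem exists_isOpenEmbedding_complex (x : S) {U : Set S} (hU : U ∈ 𝓝 x) :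
    ∃ ψ : ℂ → S, IsOpenEmbedding ψ ∧ ψ 0 = x ∧ range ψ ⊆ U := by
  let e := chartAt (EuclideanSpace ℝ (Fin 2)) x
  have hx : x ∈ e.source := mem_chart_source _ x
  have hpre : e.symm ⁻¹' U ∈ 𝓝 (e x) := by
    apply (e.continuousAt_symm (e.map_source hx)).preimage_mem_nhds
    rwa [e.left_inv hx]
  obtain ⟨r, hr, hball⟩ := Metric.mem_nhds_iff.1
    (inter_mem (e.open_target.mem_nhds (e.map_source hx)) hpre)
  let b := OpenPartialHomeomorph.univBall (e x) r
  let L := Complex.orthonormalBasisOneI.repr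
  have hbL : ∀ z : ℂ, b (L z) ∈ e.target ∩ e.symm ⁻¹' U := fun z => by
    apply hball
    rw [← OpenPartialHomeomorph.univBall_target (e x) hr]
    exact b.map_source (by simp [b])
  have h1 : IsOpenEmbedding (fun z : ℂ => b (L z)) := by
    have := b.isOpenEmbedding (by simp [b])
    exact this.comp L.toHomeomorph.isOpenEmbedding
  have h2 : Continuous (fun z : ℂ => e.symm (b (L z))) :=
    e.continuousOn_symm.comp_continuous h1.continuous fun z => (hbL z).1
  refine ⟨fun z => e.symm (b (L z)), IsOpenEmbedding.of_continuous_injective_isOpenMap h2 ?_ ?_,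
    ?_, ?_⟩
  · intro z w hzw
    exact h1.injective (e.symm.injOn (hbL z).1 (hbL w).1 hzw)
  · intro O hO
    have : (fun z : ℂ => e.symm (b (L z))) '' O = e.symm '' ((fun z : ℂ => b (L z)) '' O) := by
      rw [image_image]
    rw [this]
    exact e.symm.isOpen_image_of_subset_source (h1.isOpenMap O hO)
      (by rintro _ ⟨z, _, rfl⟩; exact (hbL z).1)
  · simp [b, e.left_inv hx]
  · rintro _ ⟨z, rfl⟩
    exact (hbL z).2

/-- Deleting a point from a connected open subset of a surface leaves a connected set. -/
theorem isPreconnected_diff_singleton {U : Set S} (hU : IsOpen U) (hc : IsPreconnected U) (x : S)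
    [T1Space S] : IsPreconnected (U \ {x}) := by
  by_cases hx : x ∈ U
  swap
  · rwa [sdiff_singleton_eq_self hx]
  obtain ⟨ψ, hψ, rfl, hψU⟩ := exists_isOpenEmbedding_complex x (hU.mem_nhds hx)
  have hB : IsPreconnected (range ψ \ {ψ 0}) := by
    have : range ψ \ {ψ 0} = ψ '' {0}ᶜ := by
      rw [image_compl_eq_range_sdiff_image hψ.injective, image_singleton]
    rw [this]
    exact (isConnected_compl_singleton_of_one_lt_rank (by simp) (0 : ℂ)).isPreconnected.image _
      hψ.continuous.continuousOn
  -- If one open set contains the whole punctured disk, adding the disk to it and removing the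
  -- centre from the other gives an open cover of `U`. Otherwise both sets meet the punctured disk,
  -- which is itself connected.
  have key : ∀ V W : Set S, IsOpen V → IsOpen W → U \ {ψ 0} ⊆ V ∪ W →
      (U \ {ψ 0} ∩ W).Nonempty → range ψ \ {ψ 0} ⊆ V → (U \ {ψ 0} ∩ (V ∩ W)).Nonempty := by
    rintro V W hV hW hcov ⟨w, ⟨hwU, hwx⟩, hwW⟩ hBV
    obtain ⟨y, hyU, hy1, hy2, hy3⟩ := hc (V ∪ range ψ) (W ∩ {ψ 0}ᶜ) (hV.union hψ.isOpen_range)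
      (hW.inter isOpen_compl_singleton)
      (fun y hy => by
        by_cases h : y = ψ 0
        · exact Or.inl (Or.inr ⟨0, h.symm⟩)
        · exact (hcov ⟨hy, h⟩).imp Or.inl fun h' => ⟨h', h⟩)
      ⟨ψ 0, hx, Or.inr ⟨0, rfl⟩⟩ ⟨w, hwU, hwW, hwx⟩
    exact ⟨y, ⟨hyU, hy3⟩, hy1.elim id fun h => hBV ⟨h, hy3⟩, hy2⟩
  intro V W hV hW hcov hVn hWn
  by_cases h1 : range ψ \ {ψ 0} ⊆ V
  · exact key V W hV hW hcov hWn h1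
  by_cases h2 : range ψ \ {ψ 0} ⊆ W
  · rw [inter_comm V W]
    exact key W V hW hV (by rwa [union_comm]) hVn h2
  have hcov' : range ψ \ {ψ 0} ⊆ V ∪ W := (sdiff_subset_sdiff_left hψU).trans hcov
  obtain ⟨a, ha, haV⟩ := not_subset.1 h1
  obtain ⟨b, hb, hbW⟩ := not_subset.1 h2
  obtain ⟨y, hy, hy'⟩ := hB V W hV hW hcov'
    ⟨b, hb, (hcov' hb).resolve_right hbW⟩ ⟨a, ha, (hcov' ha).resolve_left haV⟩
  exact ⟨y, sdiff_subset_sdiff_left hψU hy, hy'⟩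

theorem isPreconnected_diff_finite [T1Space S] {U : Set S} (hU : IsOpen U)
    (hc : IsPreconnected U) {F : Set S} (hF : F.Finite) : IsPreconnected (U \ F) := by
  induction F, hF using Set.Finite.induction_on with
  | empty => simpa
  | @insert a s _ hs ih =>
    have : U \ insert a s = (U \ s) \ {a} := by
      rw [sdiff_sdiff, union_singleton]
    rw [this]
    exact isPreconnected_diff_singleton (hU.sdiff hs.isClosed) ih a

end Charts

/-! ### Point pushing -/

section Pushes

variable {S : Type*} [TopologicalSpace S]

/-- A path is the track of a push relative to `F` if there is a homotopy from the identity to a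
homeomorphism, constant on `F`, that moves the starting point along the path. -/
def IsPushTrack (F : Set S) {y z : S} (γ : Path y z) : Prop :=
  ∃ (h : S ≃ₜ S) (H : C(I × S, S)), (∀ x, H (0, x) = x) ∧ (∀ x, H (1, x) = h x) ∧
    (∀ t, ∀ x ∈ F, H (t, x) = x) ∧ ∀ t, H (t, y) = γ t

/-- The second homotopy is precomposed with the end homeomorphism `h` of the first, which carries
`x` to `y`. -/
theorem IsPushTrack.trans {F : Set S} {x y z : S} {γ : Path x y} {γ' : Path y z}
    (hγ : IsPushTrack F γ) (hγ' : IsPushTrack F γ') : IsPushTrack F (γ.trans γ') := by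
  obtain ⟨h, H, H0, H1, HF, Hγ⟩ := hγ
  obtain ⟨k, K, K0, K1, KF, Kγ⟩ := hγ'
  let A : (ContinuousMap.id S).Homotopy (h : C(S, S)) := ⟨H, H0, H1⟩
  let B : (h : C(S, S)).Homotopy (h.trans k : C(S, S)) :=
    ⟨K.comp (ContinuousMap.prodMap (ContinuousMap.id I) (h : C(S, S))), fun x => by simp [K0],
      fun x => by simp [K1]⟩
  have hx : h x = y := by rw [← H1, Hγ, Path.target]
  refine ⟨h.trans k, (A.trans B).toContinuousMap, fun s => ?_, fun s => ?_, fun t s hs => ?_,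
    fun t => ?_⟩
  · exact (A.trans B).map_zero_left s
  · exact (A.trans B).map_one_left s
  · change A.trans B (t, s) = s
    rw [ContinuousMap.Homotopy.trans_apply]
    split_ifs
    · exact HF _ s hs
    · change K (_, h s) = s
      rw [← H1, HF _ s hs, KF _ s hs]
  · change A.trans B (t, x) = _
    rw [ContinuousMap.Homotopy.trans_apply, Path.trans_apply]
    split_ifs
    · exact Hγ _
    · change K (_, h x) = _
      rw [hx]
      exact Kγ _

/-- The radial bump used to push `y` towards `z` inside the ball of radius `r`. -/
noncomputable def bump (y : ℂ) (r : ℝ) (x : ℂ) : ℝ := max 0 (1 - ‖x - y‖ / r)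

theorem bump_eq_zero {y x : ℂ} {r : ℝ} (hr : 0 < r) (hx : x ∉ Metric.closedBall y r) :
    bump y r x = 0 := by
  rw [Metric.mem_closedBall, dist_eq_norm, not_le] at hx
  apply max_eq_left
  rw [sub_nonpos, one_le_div hr]
  exact hx.le

theorem abs_bump_sub_le {y : ℂ} {r : ℝ} (hr : 0 < r) (x x' : ℂ) :
    |bump y r x - bump y r x'| ≤ ‖x - x'‖ / r := by
  refine (abs_max_sub_max_le_max _ _ _ _).trans ?_
  rw [sub_self, abs_zero, max_eq_right (abs_nonneg _)]
  have : (1 - ‖x - y‖ / r) - (1 - ‖x' - y‖ / r) = (‖x' - y‖ - ‖x - y‖) / r := by ring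
  rw [this, abs_div, abs_of_pos hr]
  gcongr
  refine (abs_norm_sub_norm_le _ _).trans ?_
  rw [sub_sub_sub_cancel_right, norm_sub_rev]

/-- Translating by a multiple of the bump is a homeomorphism of the plane. -/
theorem exists_homeomorph_bump (y z : ℂ) {r : ℝ} (hr : ‖z - y‖ < r) :
    ∃ e : ℂ ≃ₜ ℂ, ∀ x, e x = x + bump y r x * (z - y) := by
  have hr0 : 0 < r := (norm_nonneg _).trans_lt hr
  let c : NNReal := ⟨‖z - y‖ / r, by positivity⟩
  -- The perturbation of the identity is Lipschitz with constant `‖z - y‖ / r < 1`, so the inverse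
  -- function theorem applies globally.
  have hf : ApproximatesLinearOn (fun x : ℂ => x + bump y r x * (z - y))
      ((ContinuousLinearEquiv.refl ℝ ℂ : ℂ ≃L[ℝ] ℂ) : ℂ →L[ℝ] ℂ) univ c := by
    intro a _ b _
    have : (a + bump y r a * (z - y)) - (b + bump y r b * (z - y)) -
        ((ContinuousLinearEquiv.refl ℝ ℂ : ℂ ≃L[ℝ] ℂ) : ℂ →L[ℝ] ℂ) (a - b) =
        ((bump y r a - bump y r b : ℝ) : ℂ) * (z - y) := by
      simp; ring
    rw [this, norm_mul, Complex.norm_real, Real.norm_eq_abs]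
    calc _ ≤ ‖a - b‖ / r * ‖z - y‖ := by gcongr; exact abs_bump_sub_le hr0 a b
      _ = ‖z - y‖ / r * ‖a - b‖ := by ring
  refine ⟨hf.toHomeomorph _ (Or.inr ?_), fun x => rfl⟩
  have : ‖((ContinuousLinearEquiv.refl ℝ ℂ).symm : ℂ →L[ℝ] ℂ)‖₊ = 1 := by
    ext; exact ContinuousLinearMap.norm_id
  rw [this, inv_one]
  change (⟨‖z - y‖ / r, _⟩ : NNReal) < ⟨1, zero_le_one⟩
  exact (div_lt_one hr0).2 hr

variable [T2Space S] [CompactSpace S]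

/-- The straight-line homotopy to the bump translation is extended by the identity off the chart; it
is supported in a compact ball, so the extension is continuous. The time-one map is a continuous
bijection of a compact Hausdorff space, hence a homeomorphism. -/
theorem exists_isPushTrack_of_chart {F : Set S} {ψ : ℂ → S} (hψ : IsOpenEmbedding ψ)
    (hF : Disjoint (range ψ) F) (y z : ℂ) :
    ∃ γ : Path (ψ y) (ψ z), range γ ⊆ range ψ ∧ IsPushTrack F γ := by
  let r := ‖z - y‖ + 1
  have hr : ‖z - y‖ < r := lt_add_one _
  have hr0 : 0 < r := (norm_nonneg _).trans_lt hr
  obtain ⟨e, he⟩ := exists_homeomorph_bump y z hr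
  let Φ : I × ℂ → ℂ := fun p => p.2 + (p.1 : ℝ) * bump y r p.2 * (z - y)
  have hbump : Continuous (bump y r) := by unfold bump; fun_prop
  have hΦ : Continuous Φ := by fun_prop
  have hemb : IsOpenEmbedding (Prod.map (id : I → I) ψ) := IsOpenEmbedding.id.prodMap hψ
  let C : Set (I × ℂ) := univ ×ˢ Metric.closedBall y r
  have hC : IsClosed (Prod.map (id : I → I) ψ '' C) :=
    ((isCompact_univ.prod (isCompact_closedBall y r)).image hemb.continuous).isClosed
  let G : I × S → S := Function.extend (Prod.map id ψ) (fun p => ψ (Φ p)) Prod.snd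
  have hG : Continuous G := continuous_iff_continuousAt.2 fun p =>
    continuousAt_extend hemb hC continuous_snd
      (fun p hp => by
        have : p.2 ∉ Metric.closedBall y r := fun h => hp ⟨mem_univ _, h⟩
        simp [Φ, bump_eq_zero hr0 this])
      (fun p _ => (hψ.continuous.comp hΦ).continuousAt)
  have hGψ : ∀ t w, G (t, ψ w) = ψ (Φ (t, w)) := fun t w =>
    hemb.injective.extend_apply (fun p => ψ (Φ p)) Prod.snd (t, w)
  have hGout : ∀ t x, x ∉ range ψ → G (t, x) = x := fun t x hx =>
    Function.extend_apply' _ _ _ (by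
      rintro ⟨p, hp⟩
      exact hx ⟨p.2, congrArg Prod.snd hp⟩)
  have hG1 : ∀ w, G (1, ψ w) = ψ (e w) := fun w => by rw [hGψ, he]; simp [Φ]
  have hcont1 : Continuous fun x => G (1, x) := hG.comp (by fun_prop)
  have hbij : Function.Bijective fun x => G (1, x) := by
    constructor
    · intro a b hab
      change G (1, a) = G (1, b) at hab
      by_cases ha : a ∈ range ψ <;> by_cases hb : b ∈ range ψ
      · obtain ⟨a, rfl⟩ := ha
        obtain ⟨b, rfl⟩ := hb
        rw [hG1, hG1] at hab
        rw [e.injective (hψ.injective hab)]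
      · obtain ⟨a, rfl⟩ := ha
        rw [hG1, hGout _ _ hb] at hab
        exact absurd ⟨_, hab⟩ hb
      · obtain ⟨b, rfl⟩ := hb
        rw [hG1, hGout _ _ ha] at hab
        exact absurd ⟨_, hab.symm⟩ ha
      · rwa [hGout _ _ ha, hGout _ _ hb] at hab
    · intro b
      by_cases hb : b ∈ range ψ
      · obtain ⟨b, rfl⟩ := hb
        exact ⟨ψ (e.symm b), by simp [hG1]⟩
      · exact ⟨b, hGout _ _ hb⟩
  let h : S ≃ₜ S := Continuous.homeoOfEquivCompactToT2 (f := Equiv.ofBijective _ hbij) hcont1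
  have hy : bump y r y = 1 := by simp [bump]
  refine ⟨⟨⟨fun t => ψ (Φ (t, y)), by fun_prop⟩, by simp [Φ], by simp [Φ, hy]⟩, ?_, h, ⟨G, hG⟩,
    fun x => ?_, fun x => rfl, fun t x hx => hGout t x fun hx' => hF.le_bot ⟨hx', hx⟩,
    fun t => hGψ t y⟩
  · rintro _ ⟨t, rfl⟩
    exact ⟨_, rfl⟩
  · change G (0, x) = x
    by_cases hx : x ∈ range ψ
    · obtain ⟨w, rfl⟩ := hx
      rw [hGψ]; simp [Φ]
    · exact hGout _ _ hx

variable [ChartedSpace (EuclideanSpace ℝ (Fin 2)) S]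

/-- Points of a connected open set with finitely many points deleted can be pushed onto each
other within this set. -/
theorem exists_isPushTrack {F W : Set S} (hF : F.Finite) (hW : IsOpen W)
    (hWc : IsPreconnected W) {y z : S} (hy : y ∈ W \ F) (hz : z ∈ W \ F) :
    ∃ γ : Path y z, range γ ⊆ W ∧ IsPushTrack F γ := by
  -- Being joined by a push track is transitive and holds locally in both directions, so it holds
  -- throughout the connected set `W \ F`.
  refine (isPreconnected_diff_finite hW hWc hF).induction₂'
    (fun y z => ∃ γ : Path y z, range γ ⊆ W ∧ IsPushTrack F γ) ?_ ?_ hy hz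
  · intro x hx
    obtain ⟨ψ, hψ, rfl, hψU⟩ := exists_isOpenEmbedding_complex x
      ((hW.sdiff hF.isClosed).mem_nhds hx)
    have hd : Disjoint (range ψ) F := disjoint_left.2 fun a ha => (hψU ha).2
    have hr : range ψ ⊆ W := fun a ha => (hψU ha).1
    filter_upwards [mem_nhdsWithin_of_mem_nhds (hψ.isOpen_range.mem_nhds ⟨0, rfl⟩)]
    rintro _ ⟨w, rfl⟩
    exact ⟨(exists_isPushTrack_of_chart hψ hd 0 w).imp fun _ h => ⟨h.1.trans hr, h.2⟩,
      (exists_isPushTrack_of_chart hψ hd w 0).imp fun _ h => ⟨h.1.trans hr, h.2⟩⟩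
  · rintro a b c - - - ⟨γ, h1, h2⟩ ⟨γ', h1', h2'⟩
    exact ⟨γ.trans γ', by rw [Path.trans_range]; exact union_subset h1 h1', h2.trans h2'⟩

end Pushes

/-! ### Realizing homotopy classes of paths by pushes -/

section Realization

variable {S : Type*} [TopologicalSpace S]

theorem homotopic_of_range_subset_chart {ψ : ℂ → S} (hψ : IsOpenEmbedding ψ) {y z : S}
    (γ δ : Path y z) (hγ : range γ ⊆ range ψ) (hδ : range δ ⊆ range ψ) : γ.Homotopic δ := by
  have hsc : IsSimplyConnected (range ψ) := by
    rw [← image_univ, hψ.isEmbedding.isSimplyConnected_image]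
    exact (Homeomorph.Set.univ ℂ).toHomotopyEquiv.simplyConnectedSpace
  have := hsc.simplyConnectedSpace
  have hy : y ∈ range ψ := hγ ⟨0, γ.source⟩
  have hz : z ∈ range ψ := hγ ⟨1, γ.target⟩
  let lift (η : Path y z) (h : range η ⊆ range ψ) : Path (⟨y, hy⟩ : range ψ) ⟨z, hz⟩ :=
    ⟨⟨fun t => ⟨η t, h ⟨t, rfl⟩⟩, by fun_prop⟩, by simp, by simp⟩
  exact (SimplyConnectedSpace.paths_homotopic (lift γ hγ) (lift δ hδ)).map
    ⟨Subtype.val, continuous_subtype_val⟩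

/-- A path is realizable relative to `F` if it is homotopic to the track of a push. -/
def IsRealizable (F : Set S) {y z : S} (γ : Path y z) : Prop :=
  ∃ δ : Path y z, IsPushTrack F δ ∧ δ.Homotopic γ

theorem IsRealizable.congr {F : Set S} {y z : S} {γ γ' : Path y z} (h : IsRealizable F γ)
    (h' : γ.Homotopic γ') : IsRealizable F γ' :=
  h.imp fun _ hδ => ⟨hδ.1, hδ.2.trans h'⟩

theorem IsRealizable.trans {F : Set S} {x y z : S} {γ : Path x y} {γ' : Path y z}
    (h : IsRealizable F γ) (h' : IsRealizable F γ') : IsRealizable F (γ.trans γ') := by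
  obtain ⟨δ, h1, h2⟩ := h
  obtain ⟨δ', h1', h2'⟩ := h'
  exact ⟨δ.trans δ', h1.trans h1', h2.hcomp h2'⟩

variable [ChartedSpace (EuclideanSpace ℝ (Fin 2)) S]

theorem exists_path_to_compl_finite {F : Set S} (hF : F.Finite) {U : Set S} {x : S}
    (hU : U ∈ 𝓝 x) : ∃ (y : S) (γ : Path x y), y ∉ F ∧ range γ ⊆ U := by
  obtain ⟨ψ, hψ, rfl, hψU⟩ := exists_isOpenEmbedding_complex x hU
  obtain ⟨_, ⟨w, rfl⟩, hw⟩ := (infinite_range_of_injective hψ.injective).exists_notMem_finite hF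
  let γ : Path (0 : ℂ) w := PathConnectedSpace.somePath 0 w
  refine ⟨ψ w, γ.map hψ.continuous, hw, ?_⟩
  rintro _ ⟨t, rfl⟩
  exact hψU ⟨_, rfl⟩

theorem isRealizable_of_range_subset_chart [T2Space S] [CompactSpace S] {F : Set S} (hF : F.Finite) {ψ : ℂ → S}
    (hψ : IsOpenEmbedding ψ) {y z : S} (hy : y ∉ F) (hz : z ∉ F) (γ : Path y z)
    (hγ : range γ ⊆ range ψ) : IsRealizable F γ := by
  obtain ⟨δ, hδ, hp⟩ := exists_isPushTrack hF hψ.isOpen_range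
    (isPreconnected_range hψ.continuous) (y := y) (z := z)
    ⟨hγ ⟨0, γ.source⟩, hy⟩ ⟨hγ ⟨1, γ.target⟩, hz⟩
  exact ⟨δ, hp, homotopic_of_range_subset_chart hψ δ γ hδ hγ⟩

/-- A path with arbitrary endpoints is extendably realizable if it becomes realizable whenever it
is extended, within the coordinate disks `W`, to a path with endpoints off `F`. -/
def IsExtRealizable (F : Set S) (W : S → Set S) {a b : S} (γ : Path a b) : Prop :=
  ∀ (c d : S) (δ : Path c a) (ε : Path b d), c ∉ F → d ∉ F → range δ ⊆ W a → range ε ⊆ W b →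
    IsRealizable F ((δ.trans γ).trans ε)

section

variable {F : Set S} (hF : F.Finite) {W : S → Set S}
  (hW : ∀ x, ∃ ψ : ℂ → S, IsOpenEmbedding ψ ∧ ψ 0 = x ∧ range ψ = W x)

-- The intermediate point `b` may lie in `F`. A detour `η` to a nearby point off `F` and back splits
-- the path there and cancels up to homotopy.
include hF hW in
theorem IsExtRealizable.trans {a b c : S} {γ : Path a b} {γ' : Path b c}
    (h : IsExtRealizable F W γ) (h' : IsExtRealizable F W γ') :
    IsExtRealizable F W (γ.trans γ') := by
  intro x y δ ε hx hy hδ hε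
  obtain ⟨ψ, hψ, hψ0, hψW⟩ := hW b
  obtain ⟨d, η, hd, hη⟩ := exists_path_to_compl_finite hF
    (hψ.isOpen_range.mem_nhds ⟨0, hψ0⟩)
  rw [hψW] at hη
  refine ((h x d δ η hx hd hδ hη).trans (h' d y η.symm ε hd hy ?_ hε)).congr ?_
  · rwa [Path.symm_range]
  · rw [← Path.Homotopic.Quotient.eq]
    simp only [Path.Homotopic.Quotient.mk_trans, Path.Homotopic.Quotient.mk_symm,
      Path.Homotopic.Quotient.trans_assoc]
    rw [← Path.Homotopic.Quotient.trans_assoc (.mk η), Path.Homotopic.Quotient.trans_symm,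
      Path.Homotopic.Quotient.refl_trans]

variable [T2Space S] [CompactSpace S]

-- Detours into `W a ∩ W x` and `W b ∩ W x`, ending off `F`, cut the extended path into three
-- pieces, each inside a single coordinate disk.
include hF hW in
theorem isExtRealizable_of_range_subset {x a b : S} (γ : Path a b) (hγ : range γ ⊆ W x) :
    IsExtRealizable F W γ := by
  intro c d δ ε hc hd hδ hε
  have hopen : ∀ y, IsOpen (W y) ∧ y ∈ W y := fun y => by
    obtain ⟨ψ, hψ, hψ0, hψW⟩ := hW y
    rw [← hψW]
    exact ⟨hψ.isOpen_range, 0, hψ0⟩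
  have hin : ∀ y {p q : S} (η : Path p q), p ∉ F → q ∉ F → range η ⊆ W y → IsRealizable F η :=
    fun y p q η hp hq hη => by
      obtain ⟨ψ, hψ, -, hψW⟩ := hW y
      exact isRealizable_of_range_subset_chart hF hψ hp hq η (by rwa [hψW])
  obtain ⟨c', δ', hc', hδ'⟩ := exists_path_to_compl_finite hF (x := a)
    (((hopen a).1.inter (hopen x).1).mem_nhds ⟨(hopen a).2, hγ ⟨0, γ.source⟩⟩)
  obtain ⟨d', ε', hd', hε'⟩ := exists_path_to_compl_finite hF (x := b)
    (((hopen b).1.inter (hopen x).1).mem_nhds ⟨(hopen b).2, hγ ⟨1, γ.target⟩⟩)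
  rw [subset_inter_iff] at hδ' hε'
  have h1 := hin a (δ.trans δ') hc hc' (by
    rw [Path.trans_range]; exact union_subset hδ hδ'.1)
  have h2 := hin x ((δ'.symm.trans γ).trans ε') hc' hd' (by
    rw [Path.trans_range, Path.trans_range, Path.symm_range]
    exact union_subset (union_subset hδ'.2 hγ) hε'.2)
  have h3 := hin b (ε'.symm.trans ε) hd' hd (by
    rw [Path.trans_range, Path.symm_range]; exact union_subset hε'.1 hε)
  refine ((h1.trans h2).trans h3).congr ?_
  rw [← Path.Homotopic.Quotient.eq]
  simp only [Path.Homotopic.Quotient.mk_trans, Path.Homotopic.Quotient.mk_symm,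
    Path.Homotopic.Quotient.trans_assoc]
  rw [← Path.Homotopic.Quotient.trans_assoc (.mk δ'), Path.Homotopic.Quotient.trans_symm,
    Path.Homotopic.Quotient.refl_trans, ← Path.Homotopic.Quotient.trans_assoc (.mk ε'),
    Path.Homotopic.Quotient.trans_symm, Path.Homotopic.Quotient.refl_trans]

-- The relation between `s` and `t` is transitive and holds for nearby parameters, so connectedness
-- of `I` replaces a subdivision of the path.
include hF hW in
theorem isExtRealizable_subpath {a b : S} (γ : Path a b) (s t : I) :
    IsExtRealizable F W (γ.subpath s t) := by
  refine PreconnectedSpace.induction₂' (fun s t : I => IsExtRealizable F W (γ.subpath s t))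
    (fun s => ?_) ⟨fun r s t h h' => ?_⟩ s t
  · obtain ⟨ψ, hψ, hψ0, hψW⟩ := hW (γ s)
    have hnhds : γ ⁻¹' W (γ s) ∈ 𝓝 s := γ.continuous.continuousAt.preimage_mem_nhds
      (by rw [← hψW]; exact hψ.isOpen_range.mem_nhds ⟨0, hψ0⟩)
    obtain ⟨ε, hε, hball⟩ := Metric.mem_nhds_iff.1 hnhds
    filter_upwards [Metric.ball_mem_nhds s hε] with t ht
    have hsub : γ '' uIcc s t ⊆ W (γ s) := by
      rintro _ ⟨r, hr, rfl⟩
      have hr' : (r : ℝ) ∈ uIcc (s : ℝ) t := mem_uIcc.2 (mem_uIcc.1 hr)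
      refine hball (Metric.mem_ball'.2 ((Real.dist_left_le_of_mem_uIcc hr').trans_lt ?_))
      exact Metric.mem_ball'.1 ht
    refine ⟨isExtRealizable_of_range_subset hF hW _ (x := γ s) ?_,
      isExtRealizable_of_range_subset hF hW _ (x := γ s) ?_⟩
    · rwa [Path.range_subpath]
    · rwa [Path.range_subpath, uIcc_comm]
  · intro c d δ ε hc hd hδ hε
    refine (IsExtRealizable.trans hF hW h h' c d δ ε hc hd hδ hε).congr ?_
    exact ((Path.Homotopic.refl _).hcomp ⟨Path.Homotopy.subpathTransSubpath γ r s t⟩).hcomp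
      (Path.Homotopic.refl _)

end

/-- Every path with endpoints off `F` is homotopic to the track of a push that fixes `F`. -/
theorem isRealizable_of_notMem [T2Space S] [CompactSpace S] {F : Set S} (hF : F.Finite) {a b : S} (ha : a ∉ F) (hb : b ∉ F)
    (γ : Path a b) : IsRealizable F γ := by
  choose ψ hψ hψ0 _ using fun x : S => exists_isOpenEmbedding_complex x univ_mem
  have h := isExtRealizable_subpath hF (W := fun x => range (ψ x))
    (fun x => ⟨ψ x, hψ x, hψ0 x, rfl⟩) γ 0 1 (γ 0) (γ 1) (Path.refl _) (Path.refl _)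
    (by rwa [γ.source]) (by rwa [γ.target])
    (by rintro _ ⟨-, rfl⟩; exact ⟨0, hψ0 _⟩) (by rintro _ ⟨-, rfl⟩; exact ⟨0, hψ0 _⟩)
  obtain ⟨δ, ⟨h, H, H0, H1, HF, Hδ⟩, hδ⟩ := h
  refine ⟨δ.cast γ.source.symm γ.target.symm, ⟨h, H, H0, H1, HF, fun t => ?_⟩, ?_⟩
  · exact (congrArg (fun x => H (t, x)) γ.source.symm).trans (Hδ t)
  · have h2 : δ.Homotopic (γ.subpath 0 1) := by
      refine hδ.trans ?_
      rw [← Path.Homotopic.Quotient.eq]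
      simp only [Path.Homotopic.Quotient.mk_trans, Path.Homotopic.Quotient.mk_refl,
        Path.Homotopic.Quotient.trans_refl, Path.Homotopic.Quotient.refl_trans]
    have h3 := h2.pathCast γ.source.symm γ.target.symm
    rwa [Path.subpath_zero_one] at h3

end Realization

/-! ### Parametrized arcs and essentiality -/

section ArcMaps

variable {S : Type*} [TopologicalSpace S] {P : Set S}

theorem IsArcMap.injective {α : I → S} (h : IsArcMap P α) (hne : α 0 ≠ α 1) :
    Function.Injective α := by
  have hint : ∀ t : I, t = 0 ∨ t = 1 ∨ t ∈ Ioo (0 : I) 1 := fun t => by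
    by_cases h0 : t = 0
    · exact Or.inl h0
    by_cases h1 : t = 1
    · exact Or.inr (Or.inl h1)
    exact Or.inr (Or.inr
      ⟨unitInterval.pos_iff_ne_zero.2 h0, unitInterval.lt_one_iff_ne_one.2 h1⟩)
  intro s t hst
  rcases hint s with rfl | rfl | hs <;> rcases hint t with rfl | rfl | ht
  · rfl
  · exact absurd hst hne
  · exact absurd (hst ▸ h.zero_mem) (h.notMem t ht)
  · exact absurd hst.symm hne
  · rfl
  · exact absurd (hst ▸ h.one_mem) (h.notMem t ht)
  · exact absurd (hst.symm ▸ h.zero_mem) (h.notMem s hs)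
  · exact absurd (hst.symm ▸ h.one_mem) (h.notMem s hs)
  · exact h.injOn hs ht hst

theorem IsArcMap.reverse {α : I → S} (h : IsArcMap P α) : IsArcMap P (fun t => α (σ t)) := by
  have hσ : ∀ t ∈ Ioo (0 : I) 1, σ t ∈ Ioo (0 : I) 1 := fun t ht => by
    constructor
    · rw [unitInterval.pos_iff_ne_zero, Ne, unitInterval.symm_eq_zero]
      exact ht.2.ne
    · rw [unitInterval.lt_one_iff_ne_one, Ne, unitInterval.symm_eq_one]
      exact ht.1.ne'
  exact ⟨h.continuous.comp unitInterval.continuous_symm,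
    fun s hs t ht hst => unitInterval.symm_inj.1 (h.injOn (hσ s hs) (hσ t ht) hst),
    by simpa using h.one_mem, by simpa using h.zero_mem, fun t ht => h.notMem _ (hσ t ht)⟩

theorem range_reverse {X : Type*} (α : I → X) : range (fun t => α (σ t)) = range α :=
  unitInterval.symm_bijective.surjective.range_comp α

theorem IsArcMap.comp_homeomorph {α : I → S} (h : IsArcMap P α) (k : S ≃ₜ S)
    (hk : ∀ x ∈ P, k x = x) : IsArcMap P (k ∘ α) := by
  refine ⟨k.continuous.comp h.continuous, k.injective.comp_injOn h.injOn,
    by simpa [hk _ h.zero_mem] using h.zero_mem, by simpa [hk _ h.one_mem] using h.one_mem,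
    fun t ht hP => h.notMem t ht ?_⟩
  have : k (α t) = α t := k.injective (hk _ hP)
  rwa [Function.comp_apply, this] at hP

variable [T2Space S]

/-- Two arcs with the same image and the same endpoints differ by a reparametrization. -/
theorem exists_reparam {α β : I → S} (hα : Continuous α) (hinj : Function.Injective α)
    (hβ : Continuous β) (h0 : β 0 = α 0) (h1 : β 1 = α 1) (hr : range β ⊆ range α) :
    ∃ φ : I → I, Continuous φ ∧ φ 0 = 0 ∧ φ 1 = 1 ∧ ∀ t, β t = α (φ t) := by
  have he : IsEmbedding α := (hα.isClosedEmbedding hinj).isEmbedding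
  choose φ hφ using fun t => hr (mem_range_self t)
  have : α ∘ φ = β := funext hφ
  exact ⟨φ, he.continuous_iff.2 (by rwa [this]), hinj (by rw [hφ, h0]), hinj (by rw [hφ, h1]),
    fun t => (hφ t).symm⟩

/-- An arc with distinct endpoints is essential. -/
theorem IsArcMap.not_boundsDisk {α : I → S} (h : IsArcMap P α) (hne : α 0 ≠ α 1) :
    ¬ BoundsDisk P (range α) := by
  rintro ⟨D, hD, hDinj, hDr, -⟩
  have hinj := h.injective hne
  have he : IsEmbedding α := (h.continuous.isClosedEmbedding hinj).isEmbedding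
  let C := Metric.sphere (0 : EuclideanSpace ℝ (Fin 2)) 1
  have hmem : ∀ x : C, D x ∈ range α := fun x => hDr ▸ mem_image_of_mem D x.2
  choose k hk using hmem
  have hkc : Continuous k := by
    refine he.continuous_iff.2 ?_
    have : α ∘ k = fun x : C => D x := funext hk
    rw [this]
    exact hD.comp_continuous continuous_subtype_val fun x => Metric.sphere_subset_closedBall x.2
  -- One-dimensional Borsuk–Ulam: `k` would be an injective continuous map from the circle to the
  -- interval, but the odd function `d` has a zero.
  let d : C → ℝ := fun x => (k x : ℝ) - k (-x)
  have hd : Continuous d := by fun_prop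
  have hodd : ∀ x, d (-x) = - d x := fun x => by simp [d]
  have hconn : PreconnectedSpace C := Subtype.preconnectedSpace
    (isPreconnected_sphere (Module.lt_rank_of_lt_finrank (by simp)) (0 : EuclideanSpace ℝ (Fin 2)) 1)
  obtain ⟨x₀⟩ : Nonempty C := (NormedSpace.sphere_nonempty.2 zero_le_one).to_subtype
  obtain ⟨x, hx⟩ : ∃ x, d x = 0 := by
    rcases le_total (d x₀) 0 with h | h
    · exact mem_range_of_exists_le_of_exists_ge hd ⟨x₀, h⟩ ⟨-x₀, by rw [hodd]; linarith⟩
    · exact mem_range_of_exists_le_of_exists_ge hd ⟨-x₀, by rw [hodd]; linarith⟩ ⟨x₀, h⟩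
  have hkx : k x = k (-x) := Subtype.ext (sub_eq_zero.1 hx)
  have hDx : D x = D (-x : C) := by rw [← hk, ← hk, hkx]
  have hxx := hDinj (Metric.sphere_subset_closedBall x.2)
    (Metric.sphere_subset_closedBall (-x).2) hDx
  have h0 : (x : EuclideanSpace ℝ (Fin 2)) = 0 := by
    refine (smul_eq_zero_iff_right (two_ne_zero (α := ℝ))).1 ?_
    rw [two_smul]
    nth_rewrite 2 [hxx]
    exact add_neg_cancel _
  have h1 : ‖(x : EuclideanSpace ℝ (Fin 2))‖ = 1 := mem_sphere_zero_iff_norm.1 x.2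
  rw [h0, norm_zero] at h1
  exact zero_ne_one h1

/-- The essential arc parametrized by an arc map with distinct endpoints. -/
def IsArcMap.toEssentialArc {α : I → S} (h : IsArcMap P α) (hne : α 0 ≠ α 1) : EssentialArc P :=
  ⟨range α, ⟨α, h, rfl⟩, h.not_boundsDisk hne⟩

theorem IsArcMap.endpoints_mk {α : I → S} (h : IsArcMap P α) (hne : α 0 ≠ α 1) :
    (ArcClass.mk (h.toEssentialArc hne)).endpoints = {α 0, α 1} :=
  range_inter_marked h

end ArcMaps

/-! ### Homotopy invariants of isotopy classes -/

section IsotopyInvariance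

variable {S Y : Type*} [TopologicalSpace S] [TopologicalSpace Y] {P : Set S}

theorem Isotopic.symm {A B : EssentialArc P} (h : Isotopic A B) : Isotopic B A := by
  obtain ⟨H, hc, hH, h0, h1, hA, hB⟩ := h
  refine ⟨fun s => H (σ s), hc.comp (by fun_prop : Continuous fun p : I × I => (σ p.1, p.2)),
    fun s => hH _, fun s => ?_, fun s => ?_, by simpa using hB, by simpa using hA⟩
  · exact (h0 (σ s)).trans (h0 (σ 0)).symm
  · exact (h1 (σ s)).trans (h1 (σ 0)).symm

/-- The homotopy classes in `Y` of the images under `f` of the parametrizations of `A` as an arc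
from `u` to `v`. -/
def homotopyClasses (P : Set S) (f : S → Y) (u v : S) (A : Set S) :
    Set (Path.Homotopic.Quotient (f u) (f v)) :=
  {c | ∃ α : I → S, IsArcMap P α ∧ α 0 = u ∧ α 1 = v ∧ range α = A ∧
    ∃ γ : Path (f u) (f v), (∀ t, γ t = f (α t)) ∧ .mk γ = c}

variable [T2Space S] {f : S → Y} {u v : S} (huv : u ≠ v) (hf : ContinuousOn f (Pᶜ ∪ {u, v}))

theorem homotopic_of_range_subset {α β : I → S} (hα : Continuous α)
    (hinj : Function.Injective α) (hβ : Continuous β) (h0 : β 0 = α 0) (h1 : β 1 = α 1)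
    (hr : range β ⊆ range α) {γ δ : Path (f u) (f v)} (hγ : ∀ t, γ t = f (α t))
    (hδ : ∀ t, δ t = f (β t)) : γ.Homotopic δ := by
  obtain ⟨φ, hφ, hφ0, hφ1, hφα⟩ := exists_reparam hα hinj hβ h0 h1 hr
  have : δ = γ.reparam φ hφ hφ0 hφ1 := by
    ext t
    rw [hδ, hφα, ← hγ]
    rfl
  rw [this]
  exact ⟨Path.Homotopy.reparam γ φ hφ hφ0 hφ1⟩

-- An isotopy meets `P` only in `u` and `v`, so composing it with `f` gives a homotopy of paths in
-- `Y`.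
include huv hf in
theorem homotopyClasses_subset {A B : EssentialArc P} (h : Isotopic A B) :
    homotopyClasses P f u v A.1 ⊆ homotopyClasses P f u v B.1 := by
  rintro c ⟨α, hα, hα0, hα1, hαA, γ, hγ, rfl⟩
  obtain ⟨H, hc, hH, h0, h1, hA, hB, hu, hv⟩ : ∃ H : I → I → S,
      Continuous (fun p : I × I => H p.1 p.2) ∧ (∀ s, IsArcMap P (H s)) ∧
      (∀ s, H s 0 = H 0 0) ∧ (∀ s, H s 1 = H 0 1) ∧
      range (H 0) = A.1 ∧ range (H 1) = B.1 ∧ H 0 0 = u ∧ H 0 1 = v := by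
    obtain ⟨H, hc, hH, h0, h1, hA, hB⟩ := h
    have hends : ({H 0 0, H 0 1} : Set S) = {u, v} := by
      rw [← hα0, ← hα1, ← range_inter_marked hα, ← range_inter_marked (hH 0), hA, hαA]
    -- Only the image of the initial arc is prescribed, so the isotopy may run from `v` to `u`; it
    -- is then reversed.
    rcases Set.pair_eq_pair_iff.1 hends with ⟨hu, hv⟩ | ⟨hv, hu⟩
    · exact ⟨H, hc, hH, h0, h1, hA, hB, hu, hv⟩
    · refine ⟨fun s t => H s (σ t),
        hc.comp (by fun_prop : Continuous fun p : I × I => (p.1, σ p.2)),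
        fun s => (hH s).reverse, fun s => ?_, fun s => ?_, ?_, ?_, ?_, ?_⟩
      · simp only [unitInterval.symm_zero, h1 s]
      · simp only [unitInterval.symm_one, h0 s]
      · rw [range_reverse, hA]
      · rw [range_reverse, hB]
      · simp only [unitInterval.symm_zero, hu]
      · simp only [unitInterval.symm_one, hv]
  have hmem : ∀ s t, H s t ∈ Pᶜ ∪ {u, v} := fun s t => by
    by_cases hP : H s t ∈ P
    · right
      have : H s t ∈ range (H s) ∩ P := ⟨⟨t, rfl⟩, hP⟩
      rwa [range_inter_marked (hH s), h0, h1, hu, hv] at this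
    · exact Or.inl hP
  have hfH : Continuous fun p : I × I => f (H p.1 p.2) :=
    hf.comp_continuous hc fun p => hmem p.1 p.2
  let δ (s : I) : Path (f u) (f v) :=
    ⟨⟨fun t => f (H s t), hfH.comp (by fun_prop : Continuous fun t : I => (s, t))⟩,
      by simp [h0, hu], by simp [h1, hv]⟩
  have hinj : Function.Injective α := hα.injective (by rwa [hα0, hα1])
  have hγδ : γ.Homotopic (δ 0) := homotopic_of_range_subset hα.continuous hinj
    (hH 0).continuous (hu.trans hα0.symm) (hv.trans hα1.symm) (by rw [hA, hαA]) hγ fun t => rfl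
  have hδδ : (δ 0).Homotopic (δ 1) := ⟨⟨⟨⟨fun p => f (H p.1 p.2), hfH⟩, fun t => rfl, fun t => rfl⟩,
    by rintro s t (rfl | rfl) <;> simp [δ, h0, h1]⟩⟩
  exact ⟨H 1, hH 1, (h0 1).trans hu, (h1 1).trans hv, hB, δ 1, fun t => rfl,
    (Path.Homotopic.Quotient.eq.2 (hγδ.trans hδδ)).symm⟩

include huv hf in
/-- Arcs in the same isotopy class have homotopic images under maps that are continuous off the
marked points different from the endpoints. -/
theorem homotopic_of_mk_eq_mk {α β : I → S} (hα : IsArcMap P α) (hβ : IsArcMap P β)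
    (hα0 : α 0 = u) (hα1 : α 1 = v) (hβ0 : β 0 = u) (hβ1 : β 1 = v)
    (hαn : α 0 ≠ α 1) (hβn : β 0 ≠ β 1)
    (h : ArcClass.mk (hα.toEssentialArc hαn) = ArcClass.mk (hβ.toEssentialArc hβn))
    {γ δ : Path (f u) (f v)} (hγ : ∀ t, γ t = f (α t)) (hδ : ∀ t, δ t = f (β t)) :
    γ.Homotopic δ := by
  have hclasses : homotopyClasses P f u v (range α) = homotopyClasses P f u v (range β) :=
    congrArg (Quot.lift (fun A : EssentialArc P => homotopyClasses P f u v A.1) fun A B hAB =>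
      (homotopyClasses_subset huv hf hAB).antisymm (homotopyClasses_subset huv hf hAB.symm)) h
  have hmem : Path.Homotopic.Quotient.mk γ ∈ homotopyClasses P f u v (range β) := by
    rw [← hclasses]
    exact ⟨α, hα, hα0, hα1, rfl, γ, hγ, rfl⟩
  obtain ⟨β', hβ', h0, h1, hr, γ', hγ', heq⟩ := hmem
  refine (Path.Homotopic.Quotient.eq.1 heq).symm.trans ?_
  exact (homotopic_of_range_subset hβ.continuous (hβ.injective hβn) hβ'.continuous
    (h0.trans hβ0.symm) (h1.trans hβ1.symm) hr.subset hδ hγ').symm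

end IsotopyInvariance

/-! ### Placing the marked points in one coordinate plane -/

section StandardCharts

variable {S : Type*} [TopologicalSpace S] [T2Space S] [CompactSpace S] [ConnectedSpace S]
  [ChartedSpace (EuclideanSpace ℝ (Fin 2)) S]

/-- A finite subset of a closed surface can be moved to any position within a coordinate plane. -/
theorem exists_isOpenEmbedding_through (P : Finset S) (pos : S → ℂ) (hpos : InjOn pos P) :
    ∃ ψ : ℂ → S, IsOpenEmbedding ψ ∧ ∀ x ∈ P, ψ (pos x) = x := by
  classical
  induction P using Finset.induction_on with
  | empty =>
    obtain ⟨ψ, hψ, -⟩ := exists_isOpenEmbedding_complex (Classical.arbitrary S) univ_mem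
    exact ⟨ψ, hψ, by simp⟩
  | @insert a P ha ih =>
    obtain ⟨ψ, hψ, hψP⟩ := ih (hpos.mono (by simp))
    have hy : ψ (pos a) ∉ P := fun h => ha <| by
      have h1 := hψ.injective (hψP _ h)
      have h2 := hpos (Finset.mem_insert_of_mem h) (Finset.mem_insert_self a P) h1
      rwa [h2] at h
    -- A push taking `ψ (pos a)` to `a` while fixing `P` corrects the chart at the new point.
    obtain ⟨γ, -, h, H, -, H1, HF, Hγ⟩ := exists_isPushTrack P.finite_toSet isOpen_univ
      isPreconnected_univ (y := ψ (pos a)) (z := a) ⟨mem_univ _, hy⟩ ⟨mem_univ _, ha⟩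
    refine ⟨h ∘ ψ, h.isOpenEmbedding.comp hψ, fun x hx => ?_⟩
    rcases Finset.mem_insert.1 hx with rfl | hx
    · rw [Function.comp_apply, ← H1, Hγ, Path.target]
    · rw [Function.comp_apply, hψP x hx, ← H1, HF 1 x hx]

/-- A coordinate plane in which two given marked points are at `±i`, and the other ones at
`1, -1, -3, …`. -/
theorem exists_standard_chart {P : Finset S} {u v : S} (hu : u ∈ P) (hv : v ∈ P) (huv : u ≠ v) :
    ∃ ψ : ℂ → S, IsOpenEmbedding ψ ∧ ψ Complex.I = u ∧ ψ (-Complex.I) = v ∧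
      (∀ x ∈ P, x = u ∨ x = v ∨ ∃ k : ℕ, ψ ((1 - 2 * k : ℝ) : ℂ) = x) ∧
      (4 ≤ P.card → ψ 1 ∈ P ∧ ψ (-1) ∈ P) := by
  classical
  let Q := (P.erase u).erase v
  have hQ : ∀ x, x ∈ Q ↔ x ≠ v ∧ x ≠ u ∧ x ∈ P := fun x => by simp [Q]
  let e : S → ℕ := fun x => if h : x ∈ Q then Q.equivFin ⟨x, h⟩ else 0
  have he : ∀ x (h : x ∈ Q), e x = Q.equivFin ⟨x, h⟩ := fun x h => dif_pos h
  let pos : S → ℂ := fun x => if x = u then Complex.I else if x = v then -Complex.I else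
    ((1 - 2 * e x : ℝ) : ℂ)
  have hposu : pos u = Complex.I := if_pos rfl
  have hposv : pos v = -Complex.I := by simp [pos, huv.symm]
  have hposQ : ∀ x ∈ Q, pos x = ((1 - 2 * e x : ℝ) : ℂ) := fun x hx => by
    rw [hQ] at hx
    simp [pos, hx.1, hx.2.1]
  have hcases : ∀ x ∈ P, x = u ∨ x = v ∨ x ∈ Q := fun x hx => by
    rw [hQ]; tauto
  have hII : Complex.I ≠ -Complex.I := fun h => by
    have := congrArg Complex.im h
    norm_num at this
  have hpos : InjOn pos P := by
    intro x hx y hy hxy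
    rcases hcases x hx with rfl | rfl | hxQ <;> rcases hcases y hy with rfl | rfl | hyQ
    · rfl
    · rw [hposu, hposv] at hxy
      exact absurd hxy hII
    · rw [hposu, hposQ y hyQ] at hxy
      simpa using congrArg Complex.im hxy
    · rw [hposu, hposv] at hxy
      exact absurd hxy.symm hII
    · rfl
    · rw [hposv, hposQ y hyQ] at hxy
      simpa using congrArg Complex.im hxy
    · rw [hposu, hposQ x hxQ] at hxy
      simpa using congrArg Complex.im hxy
    · rw [hposv, hposQ x hxQ] at hxy
      simpa using congrArg Complex.im hxy
    · rw [hposQ x hxQ, hposQ y hyQ, Complex.ofReal_inj] at hxy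
      have h1 : e x = e y := by
        have : (e x : ℝ) = e y := by linarith
        exact_mod_cast this
      rw [he x hxQ, he y hyQ] at h1
      exact congrArg Subtype.val (Q.equivFin.injective (Fin.ext h1))
  obtain ⟨ψ, hψ, hψP⟩ := exists_isOpenEmbedding_through P pos hpos
  refine ⟨ψ, hψ, hposu ▸ hψP u hu, hposv ▸ hψP v hv, fun x hx => ?_, fun hcard => ?_⟩
  · exact (hcases x hx).imp_right (Or.imp_right fun h => ⟨e x, hposQ x h ▸ hψP x hx⟩)
  · have hQc : Q.card = P.card - 1 - 1 := by
      rw [Finset.card_erase_of_mem (Finset.mem_erase.2 ⟨huv.symm, hv⟩), Finset.card_erase_of_mem hu]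
    -- At least two marked points remain besides `u` and `v`; those of index `0` and `1` sit at `1`
    -- and `-1`.
    have hk : ∀ k : ℕ, k < 2 → ψ ((1 - 2 * k : ℝ) : ℂ) ∈ P := fun k hk => by
      let x := Q.equivFin.symm ⟨k, by omega⟩
      have hex : e x = k := by
        rw [he x x.2]; simp [x]
      have hxP : (x : S) ∈ P := ((hQ _).1 x.2).2.2
      rw [← hex, ← hposQ x x.2, hψP x hxP]
      exact hxP
    have h0 := hk 0 (by norm_num)
    have h1 := hk 1 (by norm_num)
    norm_num at h0 h1
    exact ⟨h0, h1⟩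

end StandardCharts

/-! ### Parabolic arcs -/

section StandardArcs

variable {S : Type*} [TopologicalSpace S]

/-- The parabolic arc in the plane from `i` to `-i` that crosses the real axis at `c`. -/
noncomputable def planeArc (c : ℝ) (t : I) : ℂ := ⟨4 * c * t * (1 - t), 1 - 2 * t⟩

theorem continuous_planeArc (c : ℝ) : Continuous (planeArc c) := by
  have : planeArc c = fun t : I => ((4 * c * t * (1 - t) : ℝ) : ℂ) +
      ((1 - 2 * t : ℝ) : ℂ) * Complex.I := by
    ext t
    rw [← Complex.mk_eq_add_mul_I]
    rfl
  rw [this]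
  fun_prop

theorem planeArc_zero (c : ℝ) : planeArc c 0 = Complex.I := by
  apply Complex.ext <;> simp [planeArc]

theorem planeArc_one (c : ℝ) : planeArc c 1 = -Complex.I := by
  apply Complex.ext <;> simp [planeArc]; norm_num

theorem planeArc_injective (c : ℝ) : Function.Injective (planeArc c) := fun s t h => by
  have := congrArg Complex.im h
  simp only [planeArc] at this
  exact Subtype.ext (by linarith)

/-- The parabola meets the real axis only at `t = 1/2`, in the point `c`, so it misses the remaining
marked points. -/
theorem isArcMap_planeArc {P : Set S} {u v : S} (hu : u ∈ P) (hv : v ∈ P) {ψ : ℂ → S}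
    (hψ : IsOpenEmbedding ψ) (hψu : ψ Complex.I = u) (hψv : ψ (-Complex.I) = v)
    (hψP : ∀ x ∈ P, x = u ∨ x = v ∨ ∃ k : ℕ, ψ ((1 - 2 * k : ℝ) : ℂ) = x) {c : ℝ}
    (hc : ∀ k : ℕ, c ≠ 1 - 2 * k) : IsArcMap P (ψ ∘ planeArc c) := by
  have hinj := hψ.injective.comp (planeArc_injective c)
  have h0 : (ψ ∘ planeArc c) 0 = u := by rw [Function.comp_apply, planeArc_zero, hψu]
  have h1 : (ψ ∘ planeArc c) 1 = v := by rw [Function.comp_apply, planeArc_one, hψv]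
  refine ⟨hψ.continuous.comp (continuous_planeArc c), hinj.injOn, h0 ▸ hu, h1 ▸ hv,
    fun t ht hP => ?_⟩
  rcases hψP _ hP with h | h | ⟨k, hk⟩
  · exact ht.1.ne' (hinj (h.trans h0.symm))
  · exact ht.2.ne (hinj (h.trans h1.symm))
  · have hz := hψ.injective hk
    have him : (0 : ℝ) = 1 - 2 * t := by
      have := congrArg Complex.im hz
      rwa [Complex.ofReal_im] at this
    have hre : (1 - 2 * k : ℝ) = 4 * c * t * (1 - t) := by
      have := congrArg Complex.re hz
      rwa [Complex.ofReal_re] at this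
    have ht2 : (t : ℝ) = 1 / 2 := by linarith
    rw [ht2] at hre
    exact hc k (by linarith)

end StandardArcs

/-! ### Distinguishing arcs by winding in the punctured plane -/

section Winding

/-- A path from `-i` to `i` in the punctured plane that avoids the negative real axis is not
homotopic to one that avoids the positive real axis. -/
theorem not_homotopic_of_slitPlane {a b : {z : ℂ // z ≠ 0}} (ha : (a : ℂ) = -Complex.I)
    (hb : (b : ℂ) = Complex.I) {γ δ : Path a b} (hγ : ∀ t, (γ t : ℂ) ∈ Complex.slitPlane)
    (hδ : ∀ t, -(δ t : ℂ) ∈ Complex.slitPlane) : ¬ γ.Homotopic δ := by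
  intro h
  have hcov := Complex.isCoveringMap_exp
  -- Both paths are lifted through `exp`. The shift by `πi` makes both lifts start at `-πi/2`; they
  -- end at `πi/2` and `-3πi/2`.
  let Γ : C(I, ℂ) := ⟨fun t => Complex.log (γ t),
    Continuous.clog (by fun_prop) hγ⟩
  let Δ : C(I, ℂ) := ⟨fun t => Complex.log (-(δ t : ℂ)) - Real.pi * Complex.I,
    (Continuous.clog (by fun_prop) hδ).sub continuous_const⟩
  have hΓ0 : Γ 0 = -(Real.pi / 2) * Complex.I := by
    simp [Γ, ha, Complex.log_neg_I]
  have hΔ0 : Δ 0 = -(Real.pi / 2) * Complex.I := by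
    simp [Δ, ha, Complex.log_I]; ring
  have hΓ1 : Γ 1 = (Real.pi / 2) * Complex.I := by
    simp [Γ, hb, Complex.log_I]
  have hΔ1 : Δ 1 = -(Real.pi / 2) * Complex.I - Real.pi * Complex.I := by
    simp [Δ, hb, Complex.log_neg_I]
  have hΓexp : ∀ t, Complex.exp (Γ t) = γ t := fun t => Complex.exp_log (γ t).2
  have hΔexp : ∀ t, Complex.exp (Δ t) = δ t := fun t => by
    change Complex.exp (Complex.log (-(δ t : ℂ)) - Real.pi * Complex.I) = _
    rw [Complex.exp_sub, Complex.exp_log (neg_ne_zero.2 (δ t).2), Complex.exp_pi_mul_I]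
    simp
  have hγ0 : γ.toContinuousMap 0 = ⟨_, (Γ 0).exp_ne_zero⟩ :=
    Subtype.ext (hΓexp 0).symm
  have hδ0 : δ.toContinuousMap 0 = ⟨_, (Γ 0).exp_ne_zero⟩ := by
    rw [hΓ0, ← hΔ0]
    exact Subtype.ext (hΔexp 0).symm
  have key := hcov.liftPath_apply_one_eq_of_homotopicRel h (Γ 0) hγ0 hδ0
  have e1 := (hcov.eq_liftPath_iff' (γ_0 := hγ0)).2
    ⟨funext fun t => Subtype.ext (hΓexp t), rfl⟩
  have e2 := (hcov.eq_liftPath_iff' (γ_0 := hδ0)).2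
    ⟨funext fun t => Subtype.ext (hΔexp t), hΔ0.trans hΓ0.symm⟩
  rw [← e1, ← e2, hΓ1, hΔ1] at key
  have := congrArg Complex.im key
  simp at this
  linarith [Real.pi_pos]

/-- The Möbius map `z ↦ (z + 1) / (z - 1)`, deformed to the constant `1` near infinity. -/
noncomputable def cutoffMobius (z : ℂ) : ℂ :=
  1 + (max 0 (min 1 (2 - ‖z‖ / 4)) : ℝ) * (2 / (z - 1))

theorem cutoffMobius_of_norm_le {z : ℂ} (hz : ‖z‖ ≤ 4) (h1 : z ≠ 1) :
    cutoffMobius z = (z + 1) / (z - 1) := by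
  have h : z - 1 ≠ 0 := sub_ne_zero.2 h1
  rw [cutoffMobius, min_eq_left (by linarith), max_eq_right zero_le_one]
  field_simp
  push_cast
  ring

theorem cutoffMobius_of_le_norm {z : ℂ} (hz : 8 ≤ ‖z‖) : cutoffMobius z = 1 := by
  rw [cutoffMobius, min_eq_right (by linarith), max_eq_left (by linarith)]
  simp

/-- For `‖z‖ > 4` the term added to `1` has norm at most `2/3`. At `z = 1` division by zero gives
the value `1`. -/
theorem cutoffMobius_ne_zero {z : ℂ} (h1 : z ≠ -1) : cutoffMobius z ≠ 0 := by
  by_cases h : z = 1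
  · simp [h, cutoffMobius]
  rcases le_or_gt ‖z‖ 4 with hz | hz
  · rw [cutoffMobius_of_norm_le hz h]
    exact div_ne_zero (fun h' => h1 (eq_neg_of_add_eq_zero_left h')) (sub_ne_zero.2 h)
  · intro h0
    have hn : ‖((max 0 (min 1 (2 - ‖z‖ / 4)) : ℝ) : ℂ) * (2 / (z - 1))‖ = 1 := by
      rw [cutoffMobius] at h0
      rw [eq_neg_of_add_eq_zero_right h0]
      simp
    have h3 : 3 ≤ ‖z - 1‖ := by
      have := norm_sub_norm_le z 1
      rw [norm_one] at this
      linarith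
    rw [norm_mul, norm_div, Complex.norm_real, Real.norm_eq_abs,
      abs_of_nonneg (le_max_left _ _), Complex.norm_ofNat] at hn
    have hle : max 0 (min 1 (2 - ‖z‖ / 4)) ≤ 1 := max_le zero_le_one (min_le_left _ _)
    have : 2 / ‖z - 1‖ ≤ 2 / 3 := by gcongr
    nlinarith [div_nonneg zero_le_two (norm_nonneg (z - 1))]

theorem continuousAt_cutoffMobius {z : ℂ} (h1 : z ≠ 1) : ContinuousAt cutoffMobius z := by
  have h : z - 1 ≠ 0 := sub_ne_zero.2 h1
  unfold cutoffMobius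
  fun_prop (disch := assumption)

theorem mobius_eq {z : ℂ} (h1 : z ≠ 1) : (z + 1) / (z - 1) =
    ⟨(z.re ^ 2 + z.im ^ 2 - 1) / Complex.normSq (z - 1), -2 * z.im / Complex.normSq (z - 1)⟩ := by
  have h : Complex.normSq (z - 1) ≠ 0 := by simpa [sub_eq_zero] using h1
  apply Complex.ext
  · rw [Complex.div_re]
    field_simp
    simp
    ring
  · rw [Complex.div_im]
    field_simp
    simp
    ring

variable {S : Type*} [TopologicalSpace S] [T2Space S]

/-- The map to the punctured plane given by the cut-off Möbius map in a coordinate plane. -/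
theorem exists_map_punctured_plane {ψ : ℂ → S} (hψ : IsOpenEmbedding ψ) :
    ∃ f : S → {z : ℂ // z ≠ 0}, ContinuousOn f {ψ 1, ψ (-1)}ᶜ ∧
      ∀ z, z ≠ -1 → (f (ψ z) : ℂ) = cutoffMobius z := by
  classical
  let F : S → ℂ := Function.extend ψ cutoffMobius fun _ => 1
  have hFψ : ∀ z, F (ψ z) = cutoffMobius z := fun z => hψ.injective.extend_apply _ _ z
  have hF0 : ∀ x, x ≠ ψ (-1) → F x ≠ 0 := fun x hx => by
    by_cases h : ∃ z, ψ z = x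
    · obtain ⟨z, rfl⟩ := h
      rw [hFψ]
      exact cutoffMobius_ne_zero fun hz => hx (hz ▸ rfl)
    · rw [show F x = 1 from Function.extend_apply' _ _ _ h]
      exact one_ne_zero
  have hFc : ∀ x, x ≠ ψ 1 → ContinuousAt F x := fun x hx =>
    continuousAt_extend hψ ((isCompact_closedBall (0 : ℂ) 8).image hψ.continuous).isClosed
      continuous_const
      (fun z hz => cutoffMobius_of_le_norm (by
        rw [Metric.mem_closedBall, dist_zero_right, not_le] at hz
        exact hz.le))
      (fun z hz => continuousAt_cutoffMobius fun h => hx (h ▸ hz.symm))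
  let f : S → {z : ℂ // z ≠ 0} := fun x => if h : F x ≠ 0 then ⟨F x, h⟩ else ⟨1, one_ne_zero⟩
  have hf : ∀ x, x ≠ ψ (-1) → (f x : ℂ) = F x := fun x hx => by simp [f, hF0 x hx]
  refine ⟨f, ?_, fun z hz => ?_⟩
  · rw [IsEmbedding.subtypeVal.continuousOn_iff]
    refine ContinuousOn.congr (f := F) (fun x hx => (hFc x ?_).continuousWithinAt) fun x hx => ?_
    · exact fun h => hx (Or.inl h)
    · exact hf x fun h => hx (Or.inr h)
  · rw [hf _ (hψ.injective.ne hz), hFψ]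

theorem norm_planeArc_le {c : ℝ} (hc0 : 0 ≤ c) (hc : c ≤ 2) (t : I) : ‖planeArc c t‖ ≤ 4 := by
  refine (Complex.norm_le_abs_re_add_abs_im _).trans ?_
  have h0 := t.2.1
  have h1 := t.2.2
  have hre : |(planeArc c t).re| ≤ 2 := by
    rw [show (planeArc c t).re = 4 * c * t * (1 - t) from rfl, abs_of_nonneg]
    · nlinarith [sq_nonneg (2 * (t : ℝ) - 1), mul_nonneg h0 (sub_nonneg.2 h1)]
    · have := sub_nonneg.2 h1
      positivity
  have him : |(planeArc c t).im| ≤ 1 := by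
    rw [show (planeArc c t).im = 1 - 2 * t from rfl, abs_le]
    constructor <;> linarith
  linarith

theorem planeArc_ne_real {c r : ℝ} (hc : c ≠ r) (t : I) : planeArc c t ≠ r := by
  intro h
  have him : 1 - 2 * (t : ℝ) = 0 := by simpa [planeArc] using congrArg Complex.im h
  have hre : 4 * c * t * (1 - t) = r := by simpa [planeArc] using congrArg Complex.re h
  have ht : (t : ℝ) = 1 / 2 := by linarith
  rw [ht] at hre
  exact hc (by linarith)

/-- The parabolic arcs on different sides of the pole are sent to paths on different sides of
the origin. -/
theorem mobius_planeArc_mem_slitPlane {c s : ℝ} (hc1 : c ≠ 1) (hs : 0 < s * (c ^ 2 - 1))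
    (t : I) : s * ((planeArc c t + 1) / (planeArc c t - 1)) ∈ Complex.slitPlane := by
  have h1 : planeArc c t ≠ 1 := by exact_mod_cast planeArc_ne_real hc1 t
  have hN : 0 < Complex.normSq (planeArc c t - 1) := Complex.normSq_pos.2 (sub_ne_zero.2 h1)
  have hs0 : s ≠ 0 := by rintro rfl; simp at hs
  rw [mobius_eq h1, Complex.mem_slitPlane_iff]
  -- Off the midpoint the imaginary part is nonzero; at the midpoint the real part has the sign of
  -- `s * (c ^ 2 - 1)`.
  by_cases ht : (t : ℝ) = 1 / 2
  · left
    have : (planeArc c t).re = c ∧ (planeArc c t).im = 0 := by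
      simp only [planeArc, ht]
      constructor <;> ring
    rw [Complex.re_ofReal_mul, this.1, this.2]
    have : s * ((c ^ 2 + 0 ^ 2 - 1) / Complex.normSq (planeArc c t - 1)) =
      s * (c ^ 2 - 1) / Complex.normSq (planeArc c t - 1) := by ring
    rw [this]
    positivity
  · right
    rw [Complex.im_ofReal_mul]
    refine mul_ne_zero hs0 (div_ne_zero (mul_ne_zero (by norm_num) ?_) hN.ne')
    change 1 - 2 * (t : ℝ) ≠ 0
    intro h
    exact ht (by linarith)

variable [CompactSpace S] [ConnectedSpace S] [ChartedSpace (EuclideanSpace ℝ (Fin 2)) S]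

theorem not_one_sub_two_mul_eq (k : ℕ) : (0 : ℝ) ≠ 1 - 2 * k ∧ (2 : ℝ) ≠ 1 - 2 * k := by
  constructor
  · intro h
    have : (2 * k : ℝ) = 1 := by linarith
    norm_cast at this
    omega
  · intro h
    have : (2 * k : ℝ) ≥ 0 := by positivity
    linarith

/-- Any two marked points are joined by an essential arc. -/
theorem exists_arcMap {P : Finset S} {u v : S} (hu : u ∈ P) (hv : v ∈ P) (huv : u ≠ v) :
    ∃ α : I → S, IsArcMap (P : Set S) α ∧ α 0 = u ∧ α 1 = v := by
  obtain ⟨ψ, hψ, hψu, hψv, hψP, -⟩ := exists_standard_chart hu hv huv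
  exact ⟨ψ ∘ planeArc 0, isArcMap_planeArc (P := (P : Set S)) hu hv hψ hψu hψv hψP
    fun k => (not_one_sub_two_mul_eq k).1, by simp [planeArc_zero, hψu],
    by simp [planeArc_one, hψv]⟩

theorem exists_arcClass {P : Finset S} {u v : S} (hu : u ∈ P) (hv : v ∈ P) (huv : u ≠ v) :
    ∃ c : ArcClass (P : Set S), c.endpoints = {u, v} := by
  obtain ⟨α, hα, rfl, rfl⟩ := exists_arcMap hu hv huv
  exact ⟨_, hα.endpoints_mk huv⟩

/-- If there are at least four marked points, any two of them are joined by arcs that are not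
isotopic. -/
theorem exists_arcClass_ne_of_four_le_card {P : Finset S} {u v : S} (hu : u ∈ P) (hv : v ∈ P)
    (huv : u ≠ v) (hcard : 4 ≤ P.card) :
    ∃ c d : ArcClass (P : Set S), c.endpoints = {u, v} ∧ d.endpoints = {u, v} ∧ c ≠ d := by
  obtain ⟨ψ, hψ, hψu, hψv, hψP, hψ4⟩ := exists_standard_chart hu hv huv
  obtain ⟨f, hf, hfψ⟩ := exists_map_punctured_plane hψ
  -- The arcs crossing at `0` and `2` enclose the marked position `1` and leave `-1` outside.
  have harc0 := isArcMap_planeArc (P := (P : Set S)) hu hv hψ hψu hψv hψP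
    fun k => (not_one_sub_two_mul_eq k).1
  have harc2 := isArcMap_planeArc (P := (P : Set S)) hu hv hψ hψu hψv hψP
    fun k => (not_one_sub_two_mul_eq k).2
  have hα0 : ∀ c, (ψ ∘ planeArc c) 0 = u := fun c => by
    rw [Function.comp_apply, planeArc_zero, hψu]
  have hα1 : ∀ c, (ψ ∘ planeArc c) 1 = v := fun c => by
    rw [Function.comp_apply, planeArc_one, hψv]
  have hne : ∀ c, (ψ ∘ planeArc c) 0 ≠ (ψ ∘ planeArc c) 1 := fun c => by rwa [hα0, hα1]
  -- The two bad points of `f` are marked points other than `u` and `v`, so `f` detects isotopy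
  -- classes.
  have hnotMem : ∀ x ∈ ((P : Set S)ᶜ ∪ {u, v}), x ∉ ({ψ 1, ψ (-1)} : Set S) := by
    have h1 : ∀ z : ℂ, z.im = 0 → ψ z ≠ u ∧ ψ z ≠ v := fun z hz => by
      rw [← hψu, ← hψv]
      refine ⟨fun h => ?_, fun h => ?_⟩ <;>
      · have := congrArg Complex.im (hψ.injective h)
        simp [hz] at this
    rintro x (hx | hx) (rfl | rfl)
    · exact hx (hψ4 hcard).1
    · exact hx (hψ4 hcard).2
    · exact hx.elim (h1 1 (by simp)).1 (h1 1 (by simp)).2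
    · exact hx.elim (h1 (-1) (by simp)).1 (h1 (-1) (by simp)).2
  have hfc : ContinuousOn f ((P : Set S)ᶜ ∪ {u, v}) := hf.mono hnotMem
  have hvals : ∀ c, 0 ≤ c → c ≤ 2 → c ≠ 1 → ∀ t, (f (ψ (planeArc c t)) : ℂ) =
      (planeArc c t + 1) / (planeArc c t - 1) := fun c hc0 hc2 hc1 t => by
    rw [hfψ, cutoffMobius_of_norm_le (norm_planeArc_le hc0 hc2 t)]
    · exact_mod_cast planeArc_ne_real hc1 t
    · have := planeArc_ne_real (show c ≠ -1 by linarith) t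
      exact_mod_cast this
  have hcont : ∀ c, 0 ≤ c → c ≠ 1 → Continuous fun t => f (ψ (planeArc c t)) :=
    fun c hc0 hc1 => by
      refine hf.comp_continuous (hψ.continuous.comp (continuous_planeArc c)) fun t => ?_
      rintro (h | h)
      · exact planeArc_ne_real hc1 t (by exact_mod_cast hψ.injective h)
      · exact planeArc_ne_real (show c ≠ -1 by linarith) t (by exact_mod_cast hψ.injective h)
  let γ (c : ℝ) (hc0 : 0 ≤ c) (hc1 : c ≠ 1) : Path (f u) (f v) :=
    ⟨⟨fun t => f (ψ (planeArc c t)), hcont c hc0 hc1⟩, congrArg f (hα0 c), congrArg f (hα1 c)⟩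
  have hfu : (f u : ℂ) = -Complex.I := by
    have := hvals 0 le_rfl zero_le_two zero_ne_one 0
    rw [planeArc_zero, hψu] at this
    rw [this, div_eq_iff (fun h => by simpa using congrArg Complex.im h)]
    linear_combination Complex.I_sq
  have hfv : (f v : ℂ) = Complex.I := by
    have := hvals 0 le_rfl zero_le_two zero_ne_one 1
    rw [planeArc_one, hψv] at this
    rw [this, div_eq_iff (fun h => by simpa using congrArg Complex.im h)]
    linear_combination Complex.I_sq
  refine ⟨_, _, (harc2.endpoints_mk (hne 2)).trans (by rw [hα0, hα1]),
    (harc0.endpoints_mk (hne 0)).trans (by rw [hα0, hα1]), fun h => ?_⟩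
  refine not_homotopic_of_slitPlane hfu hfv (γ := γ 2 zero_le_two (by norm_num))
    (δ := γ 0 le_rfl zero_ne_one) (fun t => ?_) (fun t => ?_)
    (homotopic_of_mk_eq_mk huv hfc harc2 harc0 (hα0 2) (hα1 2) (hα0 0) (hα1 0) (hne 2) (hne 0) h
      (fun t => rfl) fun t => rfl)
  · have := mobius_planeArc_mem_slitPlane (c := 2) (s := 1) (by norm_num) (by norm_num) t
    rw [← hvals 2 zero_le_two le_rfl (by norm_num)] at this
    simpa [γ] using this
  · have := mobius_planeArc_mem_slitPlane (c := 0) (s := -1) (by norm_num) (by norm_num) t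
    rw [← hvals 0 le_rfl zero_le_two zero_ne_one] at this
    simpa [γ] using this

end Winding

/-! ### Pushing an endpoint around a loop -/

section PointPush

variable {S : Type*} [TopologicalSpace S] [T2Space S] [CompactSpace S]
  [ChartedSpace (EuclideanSpace ℝ (Fin 2)) S]

/-- If all arcs from `u` to `v` are isotopic, then pushing `v` around loops shows that the closed
surface is simply connected. -/
theorem subsingleton_fundamentalGroup {P : Finset S} {u v : S} (hu : u ∈ P) (huv : u ≠ v)
    {α : I → S} (hα : IsArcMap (P : Set S) α) (hα0 : α 0 = u) (hα1 : α 1 = v)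
    (hall : ∀ c d : ArcClass (P : Set S), c.endpoints = {u, v} → d.endpoints = {u, v} → c = d) :
    Subsingleton (FundamentalGroup S v) := by
  suffices h : ∀ γ : Path v v, Path.Homotopic.Quotient.mk γ = .refl v by
    refine ⟨fun a b => ?_⟩
    obtain ⟨γ, rfl⟩ := Path.Homotopic.Quotient.mk_surjective a
    obtain ⟨δ, rfl⟩ := Path.Homotopic.Quotient.mk_surjective b
    exact (h γ).trans (h δ).symm
  intro γ
  have hF : ((P : Set S) \ {v}).Finite := P.finite_toSet.subset sdiff_subset
  obtain ⟨δ, ⟨h, H, H0, H1, HF, Hδ⟩, hδγ⟩ :=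
    isRealizable_of_notMem hF (a := v) (b := v) (by simp) (by simp) γ
  rw [← Path.Homotopic.Quotient.eq.2 hδγ]
  have hv : h v = v := by rw [← H1, Hδ, δ.target]
  have hfix : ∀ x ∈ (P : Set S), h x = x := fun x hx => by
    by_cases hxv : x = v
    · rw [hxv, hv]
    · rw [← H1, HF 1 x ⟨hx, hxv⟩]
  have hHu : ∀ t, H (t, u) = u := fun t => HF t u ⟨hu, huv⟩
  have harc := hα.comp_homeomorph h hfix
  have hne : α 0 ≠ α 1 := by rwa [hα0, hα1]
  have hu' : (h ∘ α) 0 = u := by rw [Function.comp_apply, hα0, hfix u hu]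
  have hv' : (h ∘ α) 1 = v := by rw [Function.comp_apply, hα1, hv]
  have hne' : (h ∘ α) 0 ≠ (h ∘ α) 1 := by rwa [hu', hv']
  let p : Path u v := ⟨⟨α, hα.continuous⟩, hα0, hα1⟩
  let q : Path u v := ⟨⟨h ∘ α, harc.continuous⟩, hu', hv'⟩
  -- With `f = id` the invariant is the homotopy class in the closed surface `S`, the marked points
  -- being forgotten.
  have hpq : p.Homotopic q := homotopic_of_mk_eq_mk (f := id) huv continuousOn_id hα harc hα0 hα1
    hu' hv' hne hne' (hall _ _ ((hα.endpoints_mk hne).trans (by rw [hα0, hα1]))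
      ((harc.endpoints_mk hne').trans (by rw [hu', hv']))) (fun t => rfl) fun t => rfl
  let A : (ContinuousMap.id S).Homotopy (h : C(S, S)) := ⟨H, H0, H1⟩
  -- Naturality of the push along `p`: the track of `u` is constant and that of `v` is `δ`, so `p ·
  -- δ ≃ q ≃ p`, and `p` cancels.
  have hsq := (Path.Homotopic.map_trans_evalAt A p).pathCast (x₂ := u) (x₃ := v)
    rfl hv.symm
  have hl : ((p.map (map_continuous (ContinuousMap.id S))).trans (A.evalAt v)).cast rfl hv.symm =
      p.trans δ := by
    ext t
    refine (Path.trans_apply _ _ t).trans (Eq.trans ?_ (Path.trans_apply p δ t).symm)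
    split_ifs
    · rfl
    · exact Hδ _
  have hr : ((A.evalAt u).trans (p.map (map_continuous (h : C(S, S))))).cast rfl hv.symm =
      (Path.refl u).trans q := by
    ext t
    refine (Path.trans_apply _ _ t).trans (Eq.trans ?_ (Path.trans_apply _ q t).symm)
    split_ifs
    · exact hHu _
    · rfl
  have hsq' : (p.trans δ).Homotopic ((Path.refl u).trans q) := by
    rw [← hl, ← hr]
    exact hsq
  have hq := Path.Homotopic.Quotient.eq.2 hsq'
  rw [Path.Homotopic.Quotient.mk_trans, Path.Homotopic.Quotient.mk_trans,
    Path.Homotopic.Quotient.mk_refl, Path.Homotopic.Quotient.refl_trans,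
    ← Path.Homotopic.Quotient.eq.2 hpq] at hq
  have := congrArg (Path.Homotopic.Quotient.trans (Path.Homotopic.Quotient.mk p).symm) hq
  rwa [← Path.Homotopic.Quotient.trans_assoc, Path.Homotopic.Quotient.symm_trans,
    Path.Homotopic.Quotient.refl_trans] at this

end PointPush

/-! ### From connectivity to a single vertex, and the conclusion -/

section Connectivity

variable {S : Type*} [TopologicalSpace S] {P : Set S} {V : Type*} {Γ : SimpleGraph V}

theorem mem_coreVertices_of_adj {u v : V} (h : Γ.Adj u v) : u ∈ coreVertices Γ :=
  fun hu => hu v h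

/-- If the core of `Γ` has at most three vertices, any two edges of `Γ` share an endpoint, so a
connected matching arc complex consists of a single vertex. -/
theorem subsingleton_of_isConnectedComplex [Finite V] (ι : V ↪ P)
    (hcard : (coreVertices Γ).ncard ≤ 3)
    (h : IsConnectedComplex (matchingArcComplex Γ ι)) :
    Subsingleton {c : ArcClass P // c.Compatible Γ ι} := by
  classical
  refine ⟨fun a b => ?_⟩
  by_contra hab
  -- Adjacent classes would come from edges `uv` and `wx` with four distinct vertices, all in the
  -- core.
  have hnadj : ∀ c d, ¬ (oneSkeleton (matchingArcComplex Γ ι)).Adj c d := by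
    rintro c d ⟨hcd, s, hs, hcs, hds⟩
    have hdisj := (hs.2 hcs hds hcd).2
    obtain ⟨u, v, huv, hc⟩ := c.2
    obtain ⟨w, x, hwx, hd⟩ := d.2
    rw [hc, hd] at hdisj
    have hne : ∀ y ∈ ({u, v} : Set V), ∀ z ∈ ({w, x} : Set V), y ≠ z := by
      rintro y hy z hz rfl
      have hy' : (ι y : S) ∈ ({(ι u : S), (ι v : S)} : Set S) := by
        rcases hy with rfl | rfl <;> simp
      have hz' : (ι y : S) ∈ ({(ι w : S), (ι x : S)} : Set S) := by
        rcases hz with rfl | rfl <;> simp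
      exact Set.disjoint_left.1 hdisj hy' hz'
    have hsub : (({u, v, w, x} : Finset V) : Set V) ⊆ coreVertices Γ := by
      intro y hy
      simp only [Finset.coe_insert, Finset.coe_singleton, mem_insert_iff, mem_singleton_iff] at hy
      rcases hy with rfl | rfl | rfl | rfl
      · exact mem_coreVertices_of_adj huv
      · exact mem_coreVertices_of_adj huv.symm
      · exact mem_coreVertices_of_adj hwx
      · exact mem_coreVertices_of_adj hwx.symm
    have hle := (ncard_le_ncard hsub (toFinite _)).trans hcard
    have hfour : ({u, v, w, x} : Finset V).card = 4 := by
      rw [Finset.card_insert_of_notMem (by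
        simp [huv.ne, hne u (by simp) w (by simp), hne u (by simp) x (by simp)]),
        Finset.card_eq_three.2 ⟨v, w, x, hne v (by simp) w (by simp), hne v (by simp) x (by simp),
          hwx.ne, rfl⟩]
    rw [ncard_coe_finset, hfour] at hle
    omega
  have : Nontrivial {c : ArcClass P // c.Compatible Γ ι} := ⟨a, b, hab⟩
  obtain ⟨c, hc⟩ := h.preconnected.exists_adj_of_nontrivial a
  exact hnadj _ _ hc

end Connectivity

/-- The matching arc complex of a graph whose core has at most three vertices is not connected,
except possibly for a single edge on a surface of genus zero with three marked points. -/
theorem not_isConnectedComplex {S : Type*} [TopologicalSpace S] [T2Space S] [CompactSpace S]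
    [ConnectedSpace S] [ChartedSpace (EuclideanSpace ℝ (Fin 2)) S] {g : ℕ} (hgenus : HasGenus S g)
    {P : Finset S} (hχ : eulerChar g P.card < 0) {V : Type*} [Finite V] {Γ : SimpleGraph V}
    (ι : V ↪ ((P : Set S) : Type _)) (hcard : (coreVertices Γ).ncard ≤ 3)
    (hexc : ¬ (g = 0 ∧ P.card = 3 ∧ (coreVertices Γ).ncard = 2)) :
    ¬ IsConnectedComplex (matchingArcComplex Γ ι) := by
  intro hconn
  have hsub := subsingleton_of_isConnectedComplex ι hcard hconn
  obtain ⟨c₀, u, v, huv, -⟩ := hconn.nonempty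
  have hinj : ∀ {a b : V}, a ≠ b → (ι a : S) ≠ ι b := fun hab h =>
    hab (ι.injective (Subtype.ext h))
  have hall : ∀ {a b a' b' : V} (c d : ArcClass (P : Set S)), Γ.Adj a b → Γ.Adj a' b' →
      c.endpoints = {(ι a : S), (ι b : S)} → d.endpoints = {(ι a' : S), (ι b' : S)} → c = d :=
    fun c d hab hab' hc hd => congrArg Subtype.val
      (hsub.elim ⟨c, _, _, hab, hc⟩ ⟨d, _, _, hab', hd⟩)
  have hpair : ({u, v} : Set V) ⊆ coreVertices Γ := by
    rintro y (rfl | rfl)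
    · exact mem_coreVertices_of_adj huv
    · exact mem_coreVertices_of_adj huv.symm
  -- An edge at a further core vertex `w` carries a class with endpoint `w`, different from any
  -- class on `uv`.
  have hcore : coreVertices Γ = {u, v} := by
    by_contra hne
    obtain ⟨w, hw, hwuv⟩ := Set.exists_of_ssubset (hpair.ssubset_of_ne (Ne.symm hne))
    obtain ⟨x, hwx⟩ : ∃ x, Γ.Adj w x := by
      by_contra! h
      exact hw h
    obtain ⟨c, hc⟩ := exists_arcClass (ι u).2 (ι v).2 (hinj huv.ne)
    obtain ⟨d, hd⟩ := exists_arcClass (ι w).2 (ι x).2 (hinj hwx.ne)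
    have hcd := hall c d huv hwx hc hd
    have hmem : (ι w : S) ∈ c.endpoints := by rw [hcd, hd]; simp
    rw [hc] at hmem
    exact hwuv (hmem.imp (fun h => ι.injective (Subtype.ext h))
      fun h => ι.injective (Subtype.ext h))
  have hcard2 : (coreVertices Γ).ncard = 2 := by rw [hcore, Set.ncard_pair huv.ne]
  by_cases h4 : 4 ≤ P.card
  · obtain ⟨c, d, hc, hd, hcd⟩ := exists_arcClass_ne_of_four_le_card (ι u).2 (ι v).2
      (hinj huv.ne) h4
    exact hcd (hall c d huv huv hc hd)
  -- For `g = 0`, negative Euler characteristic and fewer than four marked points leave exactly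
  -- three, the excluded case.
  · have hg : g ≠ 0 := by
      rintro rfl
      unfold eulerChar at hχ
      exact hexc ⟨rfl, by omega, hcard2⟩
    obtain ⟨α, hα, hα0, hα1⟩ := exists_arcMap (ι u).2 (ι v).2 (hinj huv.ne)
    have hπ := subsingleton_fundamentalGroup (ι u).2 (hinj huv.ne) hα hα0 hα1
      fun c d hc hd => hall c d huv huv hc hd
    have hH : Subsingleton (Additive (Abelianization (FundamentalGroup S (ι v : S)))) :=
      (QuotientGroup.mk_surjective (s := commutator (FundamentalGroup S (ι v : S)))).subsingleton
    have h0 := hgenus (ι v : S)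
    rw [Module.finrank_zero_of_subsingleton] at h0
    omega

end MatchingArc

/-- The core has exactly two vertices precisely when `Γ` has exactly one edge, which is how `_hexc`
encodes the exception. Finiteness of `V` keeps `ncard` away from its default value `0` on infinite
sets. -/
theorem corollary3p3 {S : Type*} [TopologicalSpace S] [T2Space S] [CompactSpace S]
    [ConnectedSpace S] [ChartedSpace (EuclideanSpace ℝ (Fin 2)) S]
    (_horient : MatchingArc.IsOrientableSurface S)
    (g : ℕ) (_hgenus : MatchingArc.HasGenus S g)
    (P : Finset S) (_hχ : MatchingArc.eulerChar g P.card < 0)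
    {V : Type*} [Finite V] (Γ : SimpleGraph V) (ι : V ↪ ((P : Set S) : Type _))
    (_hcard : (MatchingArc.coreVertices Γ).ncard ≤ 3)
    (_hexc : ¬ (g = 0 ∧ P.card = 3 ∧ (MatchingArc.coreVertices Γ).ncard = 2)) :
    ¬ MatchingArc.IsConnectedComplex (MatchingArc.matchingArcComplex Γ ι) := by
  exact MatchingArc.not_isConnectedComplex _hgenus _hχ ι _hcard _hexc
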